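/- A family $\mathcal F$ of permutations of the vertex set of a finite graph $G$ is called pairwise suitable for $G$ if for every two disjoint edges $e,f$ of $G$ there is a permutation in $\mathcal F$ in which either all vertices of $e$ precede all vertices of $f$, or all vertices of $f$ precede all vertices of $e$. The separation dimension $\pi(G)$ is the smallest cardinality of a pairwise suitable family for $G$ (possibly $0$). Let $K_n^{1/2}$ be the graph obtained from the complete graph $K_n$ by subdividing every edge exactly once, and let $\log$ denote the logarithm to base $2$. Theorem. For every integer $n\ge 3$, $$\tfrac12\,\lfloor \log\log (n-1)\rfloor \;\le\; \pi(K_n^{1/2}),$$ and $$\pi(K_n^{1/2}) \;\le\; (1+o(1))\,\log\log (n-1)\qquad (n\to\infty),$$ that is, there is a sequence $\varepsilon_n\to 0$ such that $\pi(K_n^{1/2})\le (1+\varepsilon_n)\log\log(n-1)$ for all $n\ge 4$. -/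

import Mathlib

open Filter Topology

/-- A permutation of the vertex set of a hypergraph: a bijection from `V(H)` to an initial
segment `{0, …, |V(H)| - 1}` of the natural numbers. -/
abbrev Hypergraph.VertexPerm {α : Type*} (H : Hypergraph α) : Type _ :=
  H.vertexSet ≃ Fin H.vertexSet.ncard

/-- Every vertex in `A` precedes every vertex in `B` in the permutation `σ`. -/
def Hypergraph.VertexPerm.Precedes {α : Type*} {H : Hypergraph α} (σ : H.VertexPerm)
    (A B : Set α) : Prop :=
  ∀ a b : H.vertexSet, (a : α) ∈ A → (b : α) ∈ B → σ a < σ b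

/-- `σ` separates `A` and `B`: one of them entirely precedes the other. -/
def Hypergraph.VertexPerm.Separates {α : Type*} {H : Hypergraph α} (σ : H.VertexPerm)
    (A B : Set α) : Prop :=
  σ.Precedes A B ∨ σ.Precedes B A

/-- A family of permutations of `V(H)` is pairwise suitable for `H` if any two disjoint edges
of `H` are separated by some member of the family. -/
def Hypergraph.PairwiseSuitable {α : Type*} (H : Hypergraph α)
    (F : Finset H.VertexPerm) : Prop :=
  ∀ e ∈ H.edgeSet, ∀ f ∈ H.edgeSet, Disjoint e f → ∃ σ ∈ F, σ.Separates e f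

/-- The separation dimension `π(H)` of a (finite) hypergraph: the least cardinality of a family
of permutations that is pairwise suitable for `H`. -/
noncomputable def Hypergraph.separationDim {α : Type*} (H : Hypergraph α) : ℕ :=
  sInf {k : ℕ | ∃ F : Finset H.VertexPerm, H.PairwiseSuitable F ∧ F.card = k}

/-- On a finite hypergraph a pairwise suitable family exists, so that the infimum that defines
`Hypergraph.separationDim` is attained. -/
theorem Hypergraph.exists_pairwiseSuitable_card_eq_separationDim {α : Type*} (H : Hypergraph α)
    (hV : H.vertexSet.Finite) :
    ∃ F : Finset H.VertexPerm, H.PairwiseSuitable F ∧ F.card = H.separationDim := by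
  classical
  have : Finite H.vertexSet := hV
  have : Fintype H.vertexSet := Fintype.ofFinite _
  refine Nat.sInf_mem (s := {k : ℕ | ∃ F : Finset H.VertexPerm, H.PairwiseSuitable F ∧ F.card = k})
    ⟨_, Finset.univ, ?_, rfl⟩
  intro e _ f _ hef
  let s : H.VertexPerm := Finite.equivFinOfCardEq (Nat.card_coe_set_eq H.vertexSet)
  let g : Fin H.vertexSet.ncard → ℕ := fun i => if (s.symm i : α) ∈ e then 0 else 1
  refine ⟨s.trans (Tuple.sort g).symm, Finset.mem_univ _, Or.inl ?_⟩
  intro a b ha hb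
  by_contra hlt
  have h := Tuple.monotone_sort g (not_lt.mp hlt)
  have hb' : (b : α) ∉ e := fun h' => Set.disjoint_left.mp hef h' hb
  simp [g, ha, hb'] at h

/-- A simple graph viewed as a `2`-uniform hypergraph on the same vertices. -/
def SimpleGraph.asHypergraph {V : Type*} (G : SimpleGraph V) : Hypergraph V where
  vertexSet := Set.univ
  edgeSet := {e | ∃ u v : V, G.Adj u v ∧ e = {u, v}}
  subset_vertexSet_of_mem_edgeSet' := fun e _ => Set.subset_univ e

/-- The fully subdivided graph `G^{1/2}`: every edge of `G` is replaced by a path of length two.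
The vertices are the original vertices of `G` and one new vertex for each edge of `G`; the new
vertex of an edge is adjacent exactly to the two ends of that edge. -/
def SimpleGraph.fullSubdivision {V : Type*} (G : SimpleGraph V) :
    SimpleGraph (V ⊕ G.edgeSet) where
  Adj x y := match x, y with
    | Sum.inl v, Sum.inr e => v ∈ (e : Sym2 V)
    | Sum.inr e, Sum.inl v => v ∈ (e : Sym2 V)
    | _, _ => False
  symm := ⟨by rintro (v | e) (w | f) h <;> exact h⟩
  loopless := ⟨by rintro (v | e) h <;> exact h⟩

/-- The separation dimension of `K_n^{1/2}`, the fully subdivided clique on `n` vertices. -/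
noncomputable def sepDimSubdividedClique (n : ℕ) : ℕ :=
  (⊤ : SimpleGraph (Fin n)).fullSubdivision.asHypergraph.separationDim

/-! Lower bound: given `k` permutations and `n > 2 ^ 2 ^ (2k+1)`, iterated Erdős–Szekeres yields
more than `Q ^ 2`, `Q = 2 ^ 2 ^ k`, original vertices whose order is increasing or decreasing in
every permutation. Colour a triple of indices by a permutation separating two crossing half-edges
attached to it. Triples `(i, j, k)` and `(j, k, l)` cannot share a colour, so this properly colours
the double shift graph on `Q + 1` points with `k` colours, against
`card_le_of_doubleShift_coloring`.

Upper bound: keep the original vertices in natural order and vary only the subdivision vertices.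
Three fixed permutations handle every pair of half-edges except those whose edges span overlapping
intervals with different binary splitting heights. There are only about `log n` heights; labelling
them by the middle layer of the subsets of a `2t`-set, `2t ≈ log log n`, gives `2t` further
permutations that handle the rest. -/

/-! ### Ramsey-type tools: Erdős–Szekeres and double shift graphs. -/

/-- A long enough finite set of a linear order contains either a large subset on which `f` is
strictly increasing, or a large one on which it is strictly decreasing. -/
theorem exists_strictMonoOn_or_strictAntiOn {α β : Type*} [LinearOrder α] [LinearOrder β]
    {f : α → β} (hf : Function.Injective f) {S : Finset α} {r : ℕ} (hS : r * r < S.card) :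
    ∃ T ⊆ S, r < T.card ∧ (StrictMonoOn f (T : Set α) ∨ StrictAntiOn f (T : Set α)) := by
  classical
  -- `h x` is the largest size of an increasing chain in `S` lying strictly below `x` in both
  -- orders; `x` itself is not counted, so `h x ≥ r` already gives `r + 1` points.
  let chains : α → Finset (Finset α) := fun x =>
    S.powerset.filter fun A => StrictMonoOn f (A : Set α) ∧ ∀ a ∈ A, a < x ∧ f a < f x
  let h : α → ℕ := fun x => (chains x).sup Finset.card
  have hne : ∀ x, (chains x).Nonempty := fun x => ⟨∅, by simp [chains, StrictMonoOn]⟩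
  have hatt : ∀ x, ∃ A ∈ chains x, h x = A.card := fun x =>
    Finset.exists_mem_eq_sup _ (hne x) Finset.card
  have hmem : ∀ {x A}, A ∈ chains x ↔
      A ⊆ S ∧ StrictMonoOn f (A : Set α) ∧ ∀ a ∈ A, a < x ∧ f a < f x := by
    intro x A; simp [chains]
  have hins : ∀ {x A}, A ∈ chains x → StrictMonoOn f (insert x A : Finset α) := by
    intro x A hA a ha b hb hab
    obtain ⟨-, hA2, hA3⟩ := hmem.1 hA
    simp only [Finset.coe_insert, Set.mem_insert_iff, Finset.mem_coe] at ha hb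
    rcases ha with rfl | ha <;> rcases hb with rfl | hb
    · exact absurd hab (lt_irrefl _)
    · exact absurd hab (hA3 b hb).1.le.not_gt
    · exact (hA3 a ha).2
    · exact hA2 ha hb hab
  have hnot : ∀ {x A}, A ∈ chains x → x ∉ A := fun hA hx =>
    lt_irrefl _ ((hmem.1 hA).2.2 _ hx).1
  by_cases hbig : ∃ x ∈ S, r ≤ h x
  · obtain ⟨x, hx, hr⟩ := hbig
    obtain ⟨A, hA, hc⟩ := hatt x
    refine ⟨insert x A, Finset.insert_subset hx (hmem.1 hA).1, ?_, Or.inl (hins hA)⟩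
    rw [Finset.card_insert_of_notMem (hnot hA)]
    omega
  · push Not at hbig
    obtain ⟨y, -, hy⟩ := Finset.exists_lt_card_fiber_of_mul_lt_card_of_maps_to
      (s := S) (t := Finset.range r) (f := h) (n := r)
      (fun a ha => Finset.mem_range.2 (hbig a ha)) (by simpa using hS)
    refine ⟨_, Finset.filter_subset _ _, hy, Or.inr ?_⟩
    intro a ha b hb hab
    simp only [Finset.coe_filter, Set.mem_ofPred_eq] at ha hb
    -- Two points of one fibre of `h` in increasing position would let a longest chain below `a` be
    -- extended by `a`, forcing `h a < h b`.
    by_contra hle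
    have hlt : f a < f b := lt_of_le_of_ne (not_lt.1 hle) (hf.ne hab.ne)
    obtain ⟨A, hA, hc⟩ := hatt a
    have hA' : insert a A ∈ chains b := by
      refine hmem.2 ⟨Finset.insert_subset ha.1 (hmem.1 hA).1, hins hA, ?_⟩
      intro c hc
      rcases Finset.mem_insert.1 hc with rfl | hc
      · exact ⟨hab, hlt⟩
      · have := (hmem.1 hA).2.2 c hc
        exact ⟨this.1.trans hab, this.2.trans hlt⟩
    have h1 : (insert a A).card ≤ h b := Finset.le_sup (f := Finset.card) hA'
    rw [Finset.card_insert_of_notMem (hnot hA)] at h1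
    omega

/-- Erdős–Szekeres for finitely many injective functions simultaneously. -/
theorem exists_forall_strictMonoOn_or_strictAntiOn {ι α β : Type*} [LinearOrder α] [LinearOrder β]
    (f : ι → α → β) (hf : ∀ i, Function.Injective (f i)) (r : ℕ) (F : Finset ι) :
    ∀ S : Finset α, r ^ 2 ^ F.card < S.card → ∃ T ⊆ S, r < T.card ∧
      ∀ i ∈ F, StrictMonoOn (f i) (T : Set α) ∨ StrictAntiOn (f i) (T : Set α) := by
  classical
  induction F using Finset.induction_on with
  | empty => intro S hS; exact ⟨S, subset_rfl, by simpa using hS, by simp⟩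
  | insert i F hi ih =>
    intro S hS
    -- Each further function costs a square root of the size.
    rw [Finset.card_insert_of_notMem hi, pow_succ, pow_mul, pow_two] at hS
    obtain ⟨T, hTS, hT, hTi⟩ := exists_strictMonoOn_or_strictAntiOn (hf i) hS
    obtain ⟨U, hUT, hU, hUF⟩ := ih T hT
    refine ⟨U, hUT.trans hTS, hU, fun j hj => ?_⟩
    rcases Finset.mem_insert.1 hj with rfl | hj
    · have hsub : (U : Set α) ⊆ T := Finset.coe_subset.2 hUT
      exact hTi.imp (fun h => h.mono hsub) (fun h => h.mono hsub)
    · exact hUF j hj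

/-- The double shift graph on `N` points has no proper coloring with `k` colors if
`2 ^ 2 ^ k < N`. -/
theorem card_le_of_doubleShift_coloring {K : Type*} [Fintype K] {N : ℕ}
    (C : Fin N → Fin N → Fin N → K → Prop)
    (hC : ∀ i j k, i < j → j < k → ∃ x, C i j k x)
    (hproper : ∀ i j k l x, i < j → j < k → k < l → C i j k x → ¬ C j k l x) :
    N ≤ 2 ^ 2 ^ Fintype.card K := by
  classical
  -- Two passages to sets of colours: a proper colouring of triples induces one of pairs by subsets
  -- of `K`, and this in turn assigns distinct sets of subsets to the points.
  let B : Fin N → Fin N → Set K := fun j k => {x | ∃ i < j, C i j k x}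
  have hB : ∀ j k l, j < k → k < l → B j k ≠ B k l := by
    intro j k l hjk hkl h
    obtain ⟨x, hx⟩ := hC j k l hjk hkl
    have hx' : x ∈ B j k := h ▸ (⟨j, hjk, hx⟩ : x ∈ B k l)
    obtain ⟨i, hij, hi⟩ := hx'
    exact hproper i j k l x hij hjk hkl hi hx
  let D : Fin N → Set (Set K) := fun k => {b | ∃ j < k, b = B j k}
  have hlt : ∀ j k, j < k → D j ≠ D k := by
    intro j k hjk h
    have : B j k ∈ D j := h ▸ (⟨j, hjk, rfl⟩ : B j k ∈ D k)
    obtain ⟨i, hij, hi⟩ := this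
    exact hB i j k hij hjk hi.symm
  have hinj : Function.Injective D := by
    intro j k h
    rcases lt_trichotomy j k with hjk | rfl | hjk
    · exact absurd h (hlt _ _ hjk)
    · rfl
    · exact absurd h.symm (hlt _ _ hjk)
  simpa [Fintype.card_set] using Fintype.card_le_of_injective D hinj

/-! ### The subdivided clique and the lower bound. -/

namespace SubdividedClique

/-- The vertices of the subdivided clique `K_n^{1/2}`. -/
abbrev Vertex (n : ℕ) : Type := Fin n ⊕ (⊤ : SimpleGraph (Fin n)).edgeSet

/-- The subdivided clique `K_n^{1/2}` as a hypergraph. -/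
abbrev hypergraph (n : ℕ) : Hypergraph (Vertex n) :=
  (⊤ : SimpleGraph (Fin n)).fullSubdivision.asHypergraph

/-- The position of a vertex in a permutation. -/
def pos {n : ℕ} (σ : (hypergraph n).VertexPerm) (v : Vertex n) : ℕ := σ ⟨v, trivial⟩

theorem pos_injective {n : ℕ} (σ : (hypergraph n).VertexPerm) : Function.Injective (pos σ) := by
  intro v w h
  have := σ.injective (Fin.ext h)
  exact congrArg Subtype.val this

/-- The subdivision vertex of the edge between two distinct vertices. -/
def mid {n : ℕ} {a b : Fin n} (h : a ≠ b) : Vertex n :=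
  Sum.inr ⟨s(a, b), by simpa using h⟩

theorem separates_pair_iff {n : ℕ} {σ : (hypergraph n).VertexPerm} {v w x y : Vertex n} :
    σ.Separates {v, w} {x, y} ↔
      (pos σ v < pos σ x ∧ pos σ v < pos σ y ∧ pos σ w < pos σ x ∧ pos σ w < pos σ y) ∨
      (pos σ x < pos σ v ∧ pos σ x < pos σ w ∧ pos σ y < pos σ v ∧ pos σ y < pos σ w) := by
  have key : ∀ v w x y : Vertex n, σ.Precedes {v, w} {x, y} ↔
      (pos σ v < pos σ x ∧ pos σ v < pos σ y ∧ pos σ w < pos σ x ∧ pos σ w < pos σ y) := by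
    intro v w x y
    constructor
    · intro h
      exact ⟨h ⟨v, trivial⟩ ⟨x, trivial⟩ (by simp) (by simp),
        h ⟨v, trivial⟩ ⟨y, trivial⟩ (by simp) (by simp),
        h ⟨w, trivial⟩ ⟨x, trivial⟩ (by simp) (by simp),
        h ⟨w, trivial⟩ ⟨y, trivial⟩ (by simp) (by simp)⟩
    · rintro ⟨h1, h2, h3, h4⟩ ⟨a, _⟩ ⟨b, _⟩ ha hb
      simp only [Set.mem_insert_iff, Set.mem_singleton_iff] at ha hb
      rcases ha with rfl | rfl <;> rcases hb with rfl | rfl <;> assumption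
  exact or_congr (key _ _ _ _) (key _ _ _ _)

theorem mem_edgeSet_iff {n : ℕ} {e : Set (Vertex n)} :
    e ∈ (hypergraph n).edgeSet ↔ ∃ (v : Fin n) (u : (⊤ : SimpleGraph (Fin n)).edgeSet),
      v ∈ (u : Sym2 (Fin n)) ∧ e = {Sum.inl v, Sum.inr u} := by
  constructor
  · rintro ⟨v | v, w | w, h, rfl⟩
    · exact h.elim
    · exact ⟨v, w, h, rfl⟩
    · exact ⟨w, v, h, Set.pair_comm _ _⟩
    · exact h.elim
  · rintro ⟨v, u, h, rfl⟩
    exact ⟨Sum.inl v, Sum.inr u, h, rfl⟩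

/-- A pairwise suitable family with `k` members exists only for `n ≤ 2 ^ 2 ^ (2 * k + 1)`. -/
theorem le_of_pairwiseSuitable {n : ℕ} {F : Finset (hypergraph n).VertexPerm}
    (hF : (hypergraph n).PairwiseSuitable F) : n ≤ 2 ^ 2 ^ (2 * F.card + 1) := by
  classical
  by_contra hn
  push Not at hn
  set Q := 2 ^ 2 ^ F.card with hQ
  have hQ2 : 2 ≤ Q := by
    calc 2 = 2 ^ 1 := rfl
      _ ≤ Q := Nat.pow_le_pow_right (by norm_num) Nat.one_le_two_pow
  have hn' : (Q * Q) ^ 2 ^ F.card < (Finset.univ : Finset (Fin n)).card := by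
    have : (Q * Q) ^ 2 ^ F.card = 2 ^ 2 ^ (2 * F.card + 1) := by
      rw [hQ, ← pow_add, ← pow_mul]; congr 1; ring
    simpa [this] using hn
  obtain ⟨T, -, hT, hmono⟩ := exists_forall_strictMonoOn_or_strictAntiOn
    (fun (σ : (hypergraph n).VertexPerm) (v : Fin n) => pos σ (Sum.inl v))
    (fun σ => (pos_injective σ).comp Sum.inl_injective) _ F _ hn'
  -- Erdős–Szekeres was run with `r = Q * Q`, which is at least `2 * Q`.
  have hT' : 2 * Q + 1 ≤ T.card := by nlinarith
  obtain ⟨g, hgT, hg⟩ : ∃ g : ℕ → Fin n, (∀ i ≤ 2 * Q, g i ∈ T) ∧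
      ∀ i j, i < j → j ≤ 2 * Q → g i < g j := by
    have hpos : 0 < T.card := by omega
    refine ⟨fun i => T.orderEmbOfFin rfl (if h : i < T.card then ⟨i, h⟩ else ⟨0, hpos⟩),
      fun i _ => Finset.orderEmbOfFin_mem _ _ _, fun i j hij hj => ?_⟩
    have hj' : j < T.card := by omega
    have hi' : i < T.card := by omega
    simp [hi', hj', hij]
  have hord : ∀ σ ∈ F, (∀ i j, i < j → j ≤ 2 * Q → pos σ (.inl (g i)) < pos σ (.inl (g j))) ∨
      (∀ i j, i < j → j ≤ 2 * Q → pos σ (.inl (g j)) < pos σ (.inl (g i))) := by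
    intro σ hσ
    refine (hmono σ hσ).imp ?_ ?_ <;>
    · intro h i j hij hj
      exact h (hgT i (by omega)) (hgT j hj) (hg i j hij hj)
  -- Index `j` stands for the consecutive points `g (2j - 1)`, `g (2j)`. Writing `m i j` for the
  -- subdivision vertex of `g (2i - 1)` and `g (2j)`, the two half-edges are `g (2j - 1)` with `m j
  -- k`, and `g (2j)` with `m i j`. For `j = 0` the two points coincide by truncated subtraction,
  -- which is harmless because a middle index is positive.
  let C : Fin (Q + 1) → Fin (Q + 1) → Fin (Q + 1) → F → Prop := fun i j k σ =>
    ∃ (h1 : g (2 * i - 1) ≠ g (2 * j)) (h2 : g (2 * j - 1) ≠ g (2 * k)),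
      σ.1.Separates {Sum.inl (g (2 * j - 1)), mid h2} {Sum.inl (g (2 * j)), mid h1}
  have hcard := card_le_of_doubleShift_coloring C ?_ ?_
  · rw [Fintype.card_coe] at hcard
    omega
  · rintro ⟨i, hi⟩ ⟨j, hj⟩ ⟨k, hk⟩ hij hjk
    simp only [Fin.mk_lt_mk] at hij hjk
    have hab := hg (2 * i - 1) (2 * j - 1) (by omega) (by omega)
    have hbc := hg (2 * j - 1) (2 * j) (by omega) (by omega)
    have hcd := hg (2 * j) (2 * k) (by omega) (by omega)
    have h1 := (hab.trans hbc).ne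
    have h2 := (hbc.trans hcd).ne
    obtain ⟨σ, hσ, hs⟩ := hF {Sum.inl (g (2 * j - 1)), mid h2} (mem_edgeSet_iff.2
        ⟨_, _, Sym2.mem_mk_left _ _, rfl⟩) {Sum.inl (g (2 * j)), mid h1} (mem_edgeSet_iff.2
        ⟨_, _, Sym2.mem_mk_right _ _, rfl⟩) (by simp [mid, hbc.ne', hcd.ne, hab.ne])
    exact ⟨⟨σ, hσ⟩, h1, h2, hs⟩
  · rintro ⟨i, hi⟩ ⟨j, hj⟩ ⟨k, hk⟩ ⟨l, hl⟩ ⟨σ, hσ⟩ hij hjk hkl ⟨h1, h2, hs⟩ ⟨h3, h4, hs'⟩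
    simp only [Fin.mk_lt_mk] at hij hjk hkl
    rw [separates_pair_iff] at hs hs'
    -- If `σ` is increasing on the points, the first separation puts `m j k` before `g (2j)`, while
    -- the second puts it after `g (2k - 1)`, which itself comes after `g (2j)`. The decreasing case
    -- is the mirror image.
    rcases hord σ hσ with ho | ho
    · have o1 := ho (2 * j - 1) (2 * j) (by omega) (by omega)
      have o2 := ho (2 * j) (2 * k - 1) (by omega) (by omega)
      have o3 := ho (2 * k - 1) (2 * k) (by omega) (by omega)
      dsimp only at hs hs'
      omega
    · have o1 := ho (2 * j - 1) (2 * j) (by omega) (by omega)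
      have o2 := ho (2 * j) (2 * k - 1) (by omega) (by omega)
      have o3 := ho (2 * k - 1) (2 * k) (by omega) (by omega)
      dsimp only at hs hs'
      omega

theorem half_floor_logb_logb_le {n : ℕ} (hn : 3 ≤ n) :
    (1 / 2 : ℝ) * (⌊Real.logb 2 (Real.logb 2 ((n : ℝ) - 1))⌋ : ℝ) ≤
      (sepDimSubdividedClique n : ℝ) := by
  obtain ⟨F, hF, hFc⟩ := Hypergraph.exists_pairwiseSuitable_card_eq_separationDim (hypergraph n)
    (Set.toFinite _)
  have hle := le_of_pairwiseSuitable hF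
  have hn' : (3 : ℝ) ≤ n := by exact_mod_cast hn
  have hpos : 0 < Real.logb 2 ((n : ℝ) - 1) := Real.logb_pos (by norm_num) (by linarith)
  -- Passing from `n` to `n - 1` makes the bound strict, so the floor is at most `2 * F.card` and no
  -- additive loss remains.
  have hlt : Real.logb 2 (Real.logb 2 ((n : ℝ) - 1)) < (2 * F.card + 1 : ℕ) := by
    rw [Real.logb_lt_iff_lt_rpow (by norm_num) hpos, Real.logb_lt_iff_lt_rpow (by norm_num)
      (by linarith)]
    have : (n : ℝ) ≤ 2 ^ 2 ^ (2 * F.card + 1) := by exact_mod_cast hle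
    have h2 : ((2 : ℝ) ^ ((2 * F.card + 1 : ℕ) : ℝ)) = ((2 ^ (2 * F.card + 1) : ℕ) : ℝ) := by
      rw [Real.rpow_natCast]; push_cast; rfl
    rw [h2, Real.rpow_natCast]
    linarith
  have hfl : ⌊Real.logb 2 (Real.logb 2 ((n : ℝ) - 1))⌋ ≤ 2 * F.card := by
    have := Int.floor_lt.2 (show _ < (((2 * F.card + 1 : ℕ) : ℤ) : ℝ) by exact_mod_cast hlt)
    push_cast at this
    omega
  have hfl' : (⌊Real.logb 2 (Real.logb 2 ((n : ℝ) - 1))⌋ : ℝ) ≤ 2 * F.card := by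
    exact_mod_cast hfl
  have : sepDimSubdividedClique n = F.card := hFc.symm
  rw [this]
  linarith

end SubdividedClique

/-! ### The construction for the upper bound. -/

namespace SubdividedClique

theorem exists_div_two_pow_eq (x y : ℕ) : ∃ j, x / 2 ^ j = y / 2 ^ j := by
  refine ⟨x + y, ?_⟩
  rw [Nat.div_eq_of_lt, Nat.div_eq_of_lt]
  · exact (Nat.le_add_left _ _).trans_lt Nat.lt_two_pow_self
  · exact (Nat.le_add_right _ _).trans_lt Nat.lt_two_pow_self

/-- The number of binary digits that have to be dropped for `x` and `y` to agree. -/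
def splitHeight (x y : ℕ) : ℕ := Nat.find (exists_div_two_pow_eq x y)

theorem splitHeight_le {x y M : ℕ} (hx : x < 2 ^ M) (hy : y < 2 ^ M) : splitHeight x y ≤ M :=
  Nat.find_min' _ (by rw [Nat.div_eq_of_lt hx, Nat.div_eq_of_lt hy])

/-- The least number in `(x, y]` that has the most trailing zeros in binary. -/
def splitPoint (x y : ℕ) : ℕ := y / 2 ^ (splitHeight x y - 1) * 2 ^ (splitHeight x y - 1)

/-- At the last level where the truncations still differ, they are the two children of one node of
the binary tree, the even one belonging to the smaller number. -/
theorem exists_splitHeight_eq {x y : ℕ} (hxy : x < y) :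
    ∃ j q, splitHeight x y = j + 1 ∧ x / 2 ^ j = 2 * q ∧ y / 2 ^ j = 2 * q + 1 := by
  have hspec : x / 2 ^ splitHeight x y = y / 2 ^ splitHeight x y :=
    Nat.find_spec (exists_div_two_pow_eq x y)
  obtain ⟨j, hj⟩ : ∃ j, splitHeight x y = j + 1 := by
    refine Nat.exists_eq_add_one_of_ne_zero fun h => ?_
    rw [h] at hspec
    simp at hspec
    omega
  have hne : x / 2 ^ j ≠ y / 2 ^ j :=
    Nat.find_min (exists_div_two_pow_eq x y) (show j < splitHeight x y by omega)
  rw [hj, pow_succ, ← Nat.div_div_eq_div_mul, ← Nat.div_div_eq_div_mul] at hspec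
  have hle : x / 2 ^ j ≤ y / 2 ^ j := Nat.div_le_div_right hxy.le
  exact ⟨j, x / 2 ^ j / 2, hj, by omega, by omega⟩

/-- Two overlapping intervals with the same splitting height are split at the same point, which
lies in their intersection. -/
theorem splitPoint_eq_of_splitHeight_eq {d a c b : ℕ} (hda : d ≤ a) (hac : a < c) (hcb : c ≤ b)
    (h : splitHeight a b = splitHeight d c) :
    splitPoint d c = splitPoint a b ∧ a < splitPoint a b ∧ splitPoint a b ≤ c := by
  obtain ⟨j, q, hj, ha, hb⟩ := exists_splitHeight_eq (hac.trans_le hcb)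
  obtain ⟨j', q', hj', hd, hc⟩ := exists_splitHeight_eq (hda.trans_lt hac)
  obtain rfl : j = j' := by omega
  have h1 : d / 2 ^ j ≤ a / 2 ^ j := Nat.div_le_div_right hda
  have h2 : a / 2 ^ j ≤ c / 2 ^ j := Nat.div_le_div_right hac.le
  -- The truncation of `a` is the even number `2q` and lies between `2q'` and `2q' + 1`.
  obtain rfl : q = q' := by omega
  simp only [splitPoint, hj, hj', Nat.add_sub_cancel, hb, hc, true_and]
  refine ⟨?_, ?_⟩
  · exact (Nat.div_lt_iff_lt_mul (by positivity)).1 (by omega)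
  · exact (Nat.le_div_iff_mul_le (by positivity)).1 hc.ge

/-- Every key function on the vertices is refined by a permutation. -/
theorem exists_perm_of_key {α : Type*} [LinearOrder α] {n : ℕ} (key : Vertex n → α) :
    ∃ σ : (hypergraph n).VertexPerm, ∀ v w, key v < key w → pos σ v < pos σ w := by
  let s : (hypergraph n).VertexPerm :=
    Finite.equivFinOfCardEq (Nat.card_coe_set_eq (hypergraph n).vertexSet)
  let g : Fin (hypergraph n).vertexSet.ncard → α := fun i => key (s.symm i)
  refine ⟨s.trans (Tuple.sort g).symm, fun v w hvw => ?_⟩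
  by_contra hlt
  have h := Tuple.monotone_sort g (Fin.le_def.2 (not_lt.1 hlt))
  simp [g] at h
  exact absurd hvw h.not_gt

/-- The smaller end of an edge. -/
def lo {n : ℕ} (u : (⊤ : SimpleGraph (Fin n)).edgeSet) : ℕ := (u : Sym2 (Fin n)).inf

/-- The larger end of an edge. -/
def hi {n : ℕ} (u : (⊤ : SimpleGraph (Fin n)).edgeSet) : ℕ := (u : Sym2 (Fin n)).sup

theorem lo_lt_hi {n : ℕ} (u : (⊤ : SimpleGraph (Fin n)).edgeSet) : lo u < hi u := by
  obtain ⟨u, hu⟩ := u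
  induction u with | _ a b
  simp only [SimpleGraph.mem_edgeSet, SimpleGraph.top_adj] at hu
  simpa [lo, hi] using Ne.symm hu

theorem hi_lt {n : ℕ} (u : (⊤ : SimpleGraph (Fin n)).edgeSet) : hi u < n := Fin.is_lt _

theorem eq_lo_or_eq_hi {n : ℕ} {u : (⊤ : SimpleGraph (Fin n)).edgeSet} {v : Fin n}
    (hv : v ∈ (u : Sym2 (Fin n))) : (v : ℕ) = lo u ∨ (v : ℕ) = hi u := by
  obtain ⟨u, hu⟩ := u
  induction u with | _ a b
  simp only [Sym2.mem_iff] at hv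
  simp only [lo, hi, Sym2.inf_mk, Sym2.sup_mk]
  rcases le_total a b with h | h <;> rcases hv with rfl | rfl <;> simp [h]

theorem edge_ext {n : ℕ} {u w : (⊤ : SimpleGraph (Fin n)).edgeSet} (h1 : lo u = lo w)
    (h2 : hi u = hi w) : u = w :=
  Subtype.ext (Sym2.inf_eq_inf_and_sup_eq_sup.1 ⟨Fin.ext h1, Fin.ext h2⟩)

/-- The key that puts the subdivision vertex of an edge next to its smaller end if the splitting
height of the edge satisfies `p`, and next to its larger end otherwise. -/
noncomputable def endKey (n : ℕ) (p : ℕ → Prop) : Vertex n → ℕ :=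
  open Classical in
  Sum.elim (fun v => v) (fun u => if p (splitHeight (lo u) (hi u)) then lo u else hi u)

/-- The key that puts the subdivision vertex of an edge just before the splitting point. -/
def splitKey (n : ℕ) : Vertex n → ℕ ×ₗ ℕ ×ₗ ℕ :=
  -- Doubling leaves the odd slot `2s - 1` free between the vertices `s - 1` and `s`. Ties are
  -- broken by decreasing smaller end, then by decreasing larger end.
  Sum.elim (fun v => toLex (2 * v, toLex (0, 0)))
    (fun u => toLex (2 * splitPoint (lo u) (hi u) - 1, toLex (n - lo u, n - hi u)))

/-- `K_n^{1/2}` has a pairwise suitable family with `k + 3` members if the `M + 1` splitting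
heights have an antichain of labels among the subsets of a `k`-set. -/
theorem separationDim_le_of_antichain {n M k : ℕ} (hM : n ≤ 2 ^ M) (A : ℕ → Finset (Fin k))
    (hA : ∀ i ≤ M, ∀ j ≤ M, i ≠ j → ∃ x ∈ A i, x ∉ A j) :
    sepDimSubdividedClique n ≤ k + 3 := by
  classical
  choose τ hτ using fun p : ℕ → Prop => exists_perm_of_key (endKey n p)
  obtain ⟨ρ, hρ⟩ := exists_perm_of_key (splitKey n)
  let F : Finset (hypergraph n).VertexPerm :=
    Finset.univ.image (fun x : Fin k => τ fun h => x ∈ A h) ∪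
      {τ fun _ => True, τ fun _ => False, ρ}
  have hFc : F.card ≤ k + 3 := (Finset.card_union_le _ _).trans
    (add_le_add (Finset.card_image_le.trans (by simp)) Finset.card_le_three)
  refine le_trans (Nat.sInf_le ⟨F, ?_, rfl⟩) hFc
  have key : ∀ (v w : Fin n) (e f : (⊤ : SimpleGraph (Fin n)).edgeSet),
      v ∈ (e : Sym2 (Fin n)) → w ∈ (f : Sym2 (Fin n)) → v < w → e ≠ f →
      ∃ σ ∈ F, σ.Separates {Sum.inl v, Sum.inr e} {Sum.inl w, Sum.inr f} := by
    intro v w e f hv hw hvw hef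
    have hvw' : (v : ℕ) < w := hvw
    have hle := lo_lt_hi e
    have hlf := lo_lt_hi f
    have hnle := hi_lt e
    have hnlf := hi_lt f
    have hend : ∀ p : ℕ → Prop, endKey n p (.inl v) < endKey n p (.inl w) →
        endKey n p (.inl v) < endKey n p (.inr f) → endKey n p (.inr e) < endKey n p (.inl w) →
        endKey n p (.inr e) < endKey n p (.inr f) →
        (τ p).Separates {Sum.inl v, Sum.inr e} {Sum.inl w, Sum.inr f} :=
      fun p h1 h2 h3 h4 => separates_pair_iff.2 (Or.inl
        ⟨hτ p _ _ h1, hτ p _ _ h2, hτ p _ _ h3, hτ p _ _ h4⟩)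
    have hL : (v : ℕ) < lo f → lo e < w → lo e < lo f →
        ∃ σ ∈ F, σ.Separates {Sum.inl v, Sum.inr e} {Sum.inl w, Sum.inr f} := fun h1 h2 h3 =>
      ⟨τ fun _ => True, by simp [F], hend _ (by simpa [endKey] using hvw')
        (by simpa [endKey] using h1) (by simpa [endKey] using h2) (by simpa [endKey] using h3)⟩
    have hR : (v : ℕ) < hi f → hi e < w → hi e < hi f →
        ∃ σ ∈ F, σ.Separates {Sum.inl v, Sum.inr e} {Sum.inl w, Sum.inr f} := fun h1 h2 h3 =>
      ⟨τ fun _ => False, by simp [F], hend _ (by simpa [endKey] using hvw')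
        (by simpa [endKey] using h1) (by simpa [endKey] using h2) (by simpa [endKey] using h3)⟩
    rcases eq_lo_or_eq_hi hw with hw | hw
    · rcases eq_lo_or_eq_hi hv with hv | hv <;> exact hL (by omega) (by omega) (by omega)
    rcases eq_lo_or_eq_hi hv with hv | hv
    swap
    · exact hR (by omega) (by omega) (by omega)
    rcases lt_or_ge (hi e) w with hb | hb
    · exact hR (by omega) (by omega) (by omega)
    rcases lt_or_ge (v : ℕ) (lo f) with hd | hd
    · exact hL (by omega) (by omega) (by omega)
    -- What remains is `lo f ≤ lo e = v < w = hi f ≤ hi e`. Equal heights give a common splitting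
    -- point in `(v, w]`, so `ρ` puts both subdivision vertices between `v` and `w`, with `e` first
    -- by the tie-break. For different heights, a label `x` of `e` missing from `f` moves `e` to `v`
    -- and `f` to `w`.
    by_cases hh : splitHeight (lo e) (hi e) = splitHeight (lo f) (hi f)
    · obtain ⟨h1, h2, h3⟩ := splitPoint_eq_of_splitHeight_eq (d := lo f) (a := lo e) (c := hi f)
        (b := hi e) (by omega) (by omega) (by omega) hh
      have hne : lo f < lo e ∨ lo f = lo e ∧ hi f < hi e := by
        by_contra hcon
        exact hef (edge_ext (by omega) (by omega))
      refine ⟨ρ, by simp [F], separates_pair_iff.2 (Or.inl ⟨hρ _ _ ?_, hρ _ _ ?_, hρ _ _ ?_,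
        hρ _ _ ?_⟩)⟩ <;> simp only [splitKey, Sum.elim_inl, Sum.elim_inr, Prod.Lex.toLex_lt_toLex]
        <;> omega
    · obtain ⟨x, hxe, hxf⟩ := hA _ (splitHeight_le (M := M) (by omega) (by omega)) _
        (splitHeight_le (M := M) (by omega) (by omega)) hh
      refine ⟨τ fun h => x ∈ A h, by simp [F], hend _ ?_ ?_ ?_ ?_⟩ <;>
        simp only [endKey, Sum.elim_inl, Sum.elim_inr, hxe, hxf, if_true, if_false] <;> omega
  intro E hE E' hE' hdisj
  obtain ⟨v, e, hv, rfl⟩ := mem_edgeSet_iff.1 hE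
  obtain ⟨w, f, hw, rfl⟩ := mem_edgeSet_iff.1 hE'
  simp only [Set.disjoint_insert_left, Set.disjoint_singleton_left, Set.mem_insert_iff,
    Set.mem_singleton_iff, not_or, Sum.inl.injEq, Sum.inr.injEq] at hdisj
  rcases lt_or_gt_of_ne hdisj.1.1 with h | h
  · exact key v w e f hv hw h hdisj.2.2
  · obtain ⟨σ, hσ, hs⟩ := key w v f e hw hv h (Ne.symm hdisj.2.2)
    exact ⟨σ, hσ, hs.symm⟩

/-- The `t`-subsets of a `2t`-set form an antichain of central binomial size, large enough to label
all heights `0, …, M`. -/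
theorem separationDim_le_of_centralBinom {n M t : ℕ} (hM : n ≤ 2 ^ M)
    (ht : M + 1 ≤ t.centralBinom) : sepDimSubdividedClique n ≤ 2 * t + 3 := by
  classical
  have hcard : Fintype.card (Fin (M + 1)) ≤
      Fintype.card ((Finset.univ : Finset (Fin (2 * t))).powersetCard t) := by
    rw [Fintype.card_coe, Finset.card_powersetCard]
    simpa [Nat.centralBinom_eq_two_mul_choose] using ht
  obtain ⟨φ⟩ := Function.Embedding.nonempty_of_card_le hcard
  refine separationDim_le_of_antichain hM (fun i => if h : i < M + 1 then (φ ⟨i, h⟩).1 else ∅) ?_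
  intro i hi j hj hij
  have hi' := Nat.lt_succ_of_le hi
  have hj' := Nat.lt_succ_of_le hj
  simp only [hi', hj', dif_pos]
  rw [← Finset.not_subset]
  intro hsub
  have hc : ∀ x, (φ x).1.card = t := fun x => (Finset.mem_powersetCard.1 (φ x).2).2
  have heq := Finset.eq_of_subset_of_card_le hsub (by rw [hc, hc])
  have := φ.injective (Subtype.ext heq)
  simp at this
  exact hij this

end SubdividedClique

/-! ### Asymptotics and conclusion. -/

namespace SubdividedClique

theorem tendsto_logb_logb_sub_one :
    Tendsto (fun n : ℕ => Real.logb 2 (Real.logb 2 ((n : ℝ) - 1))) atTop atTop := by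
  have h := Real.tendsto_logb_atTop (b := 2) (by norm_num)
  exact h.comp (h.comp (tendsto_atTop_add_const_right _ (-1) tendsto_natCast_atTop_atTop))

theorem logb_logb_sub_one_pos {n : ℕ} (hn : 4 ≤ n) :
    0 < Real.logb 2 (Real.logb 2 ((n : ℝ) - 1)) := by
  have hn' : (4 : ℝ) ≤ n := by exact_mod_cast hn
  refine Real.logb_pos (by norm_num) ?_
  rw [Real.lt_logb_iff_rpow_lt (by norm_num) (by linarith)]
  norm_num
  linarith

/-- The central binomial coefficient of `t` exceeds `2 ^ x + 3` for suitable `t` slightly larger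
than `x / 2`. -/
theorem eventually_exists_le_centralBinom {δ : ℝ} (hδ : 0 < δ) :
    ∀ᶠ x : ℝ in atTop, ∃ t : ℕ, (2 * t + 3 : ℝ) ≤ (1 + δ) * x ∧
      (2 : ℝ) ^ x + 3 ≤ t.centralBinom := by
  have hb : 0 < δ / 2 * Real.log 2 := by have := Real.log_pos one_lt_two; positivity
  -- With `s = (1 + δ/2) x / 2` this constant gives `16 s ≤ 2 ^ (δ x / 2)`. The exponential gain
  -- thus absorbs both the factor `2t` in the central binomial bound and the factor `4` lost by
  -- rounding `s` down, leaving `2 * 2 ^ x`.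
  have hc : (0 : ℝ) < 1 / (8 * (1 + δ / 2)) := by positivity
  filter_upwards [(isLittleO_pow_exp_pos_mul_atTop 1 hb).bound hc, eventually_ge_atTop 2,
    eventually_ge_atTop (6 / δ)] with x hx hx2 hxδ
  have hexp : Real.exp (δ / 2 * Real.log 2 * x) = (2 : ℝ) ^ (δ / 2 * x) := by
    rw [Real.rpow_def_of_pos two_pos]; ring_nf
  rw [pow_one, hexp, Real.norm_of_nonneg (by linarith), Real.norm_of_nonneg (by positivity),
    one_div, ← div_eq_inv_mul, le_div_iff₀ (by positivity)] at hx
  rw [div_le_iff₀ hδ] at hxδ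
  set s : ℝ := (1 + δ / 2) * x / 2 with hs
  have hs1 : 1 ≤ s := by rw [hs]; nlinarith
  refine ⟨⌊s⌋₊, ?_, ?_⟩
  · have := Nat.floor_le (show 0 ≤ s by linarith)
    linarith
  · set t := ⌊s⌋₊
    have hts : (t : ℝ) ≤ s := Nat.floor_le (by linarith)
    have hst : s < t + 1 := Nat.lt_floor_add_one s
    have ht : 0 < t := Nat.floor_pos.2 hs1
    have ht' : (0 : ℝ) < t := by exact_mod_cast ht
    have hcb : ((4 : ℝ) ^ t) ≤ 2 * t * t.centralBinom := by
      exact_mod_cast Nat.four_pow_le_two_mul_self_mul_centralBinom t ht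
    have h4 : (2 : ℝ) ^ x * 2 ^ (δ / 2 * x) / 4 ≤ 4 ^ t := by
      rw [show (4 : ℝ) ^ t = 2 ^ (2 * (t : ℝ)) by
        rw [Real.rpow_mul (by norm_num), Real.rpow_natCast]; norm_num]
      rw [div_le_iff₀ (by norm_num), ← Real.rpow_add two_pos,
        show (4 : ℝ) = 2 ^ (2 : ℝ) by norm_num, ← Real.rpow_add two_pos]
      exact Real.rpow_le_rpow_of_exponent_le (by norm_num) (by linarith)
    have h2x : (4 : ℝ) ≤ 2 ^ x := by
      calc (4 : ℝ) = 2 ^ (2 : ℝ) := by norm_num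
        _ ≤ 2 ^ x := Real.rpow_le_rpow_of_exponent_le (by norm_num) hx2
    have h16 : 16 * (t : ℝ) ≤ 2 ^ (δ / 2 * x) := by linarith
    have h5 : (2 : ℝ) ^ x * (16 * t) ≤ 2 ^ x * 2 ^ (δ / 2 * x) :=
      mul_le_mul_of_nonneg_left h16 (by positivity)
    have h6 : 2 * t * (2 * (2 : ℝ) ^ x) ≤ 2 * t * t.centralBinom := by linarith
    have := le_of_mul_le_mul_left h6 (by positivity)
    linarith

theorem eventually_sepDim_le {δ : ℝ} (hδ : 0 < δ) :
    ∀ᶠ n : ℕ in atTop, (sepDimSubdividedClique n : ℝ) ≤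
      (1 + δ) * Real.logb 2 (Real.logb 2 ((n : ℝ) - 1)) := by
  filter_upwards [tendsto_logb_logb_sub_one.eventually (eventually_exists_le_centralBinom hδ),
    eventually_ge_atTop 4] with n ⟨t, ht, hcb⟩ hn
  have hn' : (4 : ℝ) ≤ n := by exact_mod_cast hn
  set l := Real.logb 2 ((n : ℝ) - 1) with hl
  have hl0 : 0 < l := Real.logb_pos (by norm_num) (by linarith)
  rw [Real.rpow_logb two_pos (by norm_num) hl0] at hcb
  have hceil := Nat.ceil_lt_add_one hl0.le
  -- The extra `1` in the exponent pays for `n - 1` in place of `n`. There are then `⌈l⌉₊ + 2 < l +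
  -- 3` heights, whence the `+ 3` in `eventually_exists_le_centralBinom`.
  have hM : n ≤ 2 ^ (⌈l⌉₊ + 1) := by
    have h1 : (n : ℝ) - 1 = 2 ^ l := (Real.rpow_logb two_pos (by norm_num) (by linarith)).symm
    have h2 : (2 : ℝ) ^ l ≤ 2 ^ (⌈l⌉₊ : ℝ) :=
      Real.rpow_le_rpow_of_exponent_le (by norm_num) (Nat.le_ceil l)
    rw [Real.rpow_natCast] at h2
    have : (n : ℝ) ≤ 2 ^ (⌈l⌉₊ + 1) := by rw [pow_succ]; linarith
    exact_mod_cast this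
  have hM' : ⌈l⌉₊ + 1 + 1 ≤ t.centralBinom := by
    have : ((⌈l⌉₊ + 1 + 1 : ℕ) : ℝ) ≤ t.centralBinom := by push_cast; linarith
    exact_mod_cast this
  have h := separationDim_le_of_centralBinom hM hM'
  have h' : (sepDimSubdividedClique n : ℝ) ≤ 2 * t + 3 := by exact_mod_cast h
  exact h'.trans ht

end SubdividedClique

theorem mainTheorem5 :
    (∀ n : ℕ, 3 ≤ n →
      (1 / 2 : ℝ) * (⌊Real.logb 2 (Real.logb 2 ((n : ℝ) - 1))⌋ : ℝ) ≤
        (sepDimSubdividedClique n : ℝ)) ∧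
    (∃ ε : ℕ → ℝ, Tendsto ε atTop (𝓝 0) ∧
      ∀ n : ℕ, 4 ≤ n →
        (sepDimSubdividedClique n : ℝ) ≤
          (1 + ε n) * Real.logb 2 (Real.logb 2 ((n : ℝ) - 1))) := by
  -- The ratio is only bounded above asymptotically by `1`, so its excess over `1` is truncated at
  -- `0` to obtain a null sequence.
  refine ⟨fun n hn => SubdividedClique.half_floor_logb_logb_le hn, fun n =>
    max 0 ((sepDimSubdividedClique n : ℝ) / Real.logb 2 (Real.logb 2 ((n : ℝ) - 1)) - 1), ?_, ?_⟩
  · refine Metric.tendsto_nhds.2 fun δ hδ => ?_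
    filter_upwards [SubdividedClique.eventually_sepDim_le (half_pos hδ),
      eventually_ge_atTop 4] with n h hn
    rw [Real.dist_eq, sub_zero, abs_of_nonneg (le_max_left _ _)]
    refine max_lt hδ ?_
    rw [← div_le_iff₀ (SubdividedClique.logb_logb_sub_one_pos hn)] at h
    linarith
  · intro n hn
    have h : (sepDimSubdividedClique n : ℝ) / Real.logb 2 (Real.logb 2 ((n : ℝ) - 1)) ≤
        1 + max 0 ((sepDimSubdividedClique n : ℝ) /
          Real.logb 2 (Real.logb 2 ((n : ℝ) - 1)) - 1) := by
      have := le_max_right (0 : ℝ) ((sepDimSubdividedClique n : ℝ) /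
        Real.logb 2 (Real.logb 2 ((n : ℝ) - 1)) - 1)
      linarith
    exact (div_le_iff₀ (SubdividedClique.logb_logb_sub_one_pos hn)).1 h
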